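/- Let $r<2$ be a real number with $r\neq 0,1$, and let $m\ge 1$ be an integer. For every integer $N\ge 1$ the limit $$L(N)=\lim_{M\to\infty}\Bigg[2r(1+r)\sum_{k=1}^M\frac{\Gamma(Nk+1)}{\Gamma(Nk+2-r)}+2r(1-r)\sum_{k=1}^M\frac{\Gamma(Nk)}{\Gamma(Nk+2-r)}-2(1+r)N^{r-1}M^r-r(N+r+Nr-r^2)N^{r-2}M^{r-1}\Bigg]$$ exists and is finite, and, as $N\to+\infty$ through the integers (with $r$ and $m$ fixed), $$L(N)=2r(1+r)\sum_{j=0}^{m-1}\frac{B_{2j}^{(r)}\!\left(\frac r2\right)(1-r)_{2j}}{(2j)!}\,N^{r-1-2j}\,\zeta\!\left(1-r+2j,\,1+\tfrac{2-r}{2N}\right)$$ $$\qquad+2r(1-r)\sum_{j=0}^{m-1}\frac{B_{2j}^{(r-1)}\!\left(\frac{r-1}2\right)(2-r)_{2j}}{(2j)!}\,N^{r-2-2j}\,\zeta\!\left(2-r+2j,\,1+\tfrac{1-r}{2N}\right)+O\!\left(N^{r-1-2m}\right).$$ Here $(x)_n=x(x+1)\cdots(x+n-1)$ is the rising factorial;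 $B_n^{(\alpha)}(x)$ are the generalized Bernoulli polynomials, defined by $\left(\frac{t}{e^t-1}\right)^{\alpha}e^{xt}=\sum_{n\ge 0}B_n^{(\alpha)}(x)\frac{t^n}{n!}$ for $|t|<2\pi$; and $\zeta(s,a)$, for $a>0$, is the Hurwitz zeta function, the analytic continuation to $s\in\mathbb C\setminus\{1\}$ of $\sum_{n\ge 0}(n+a)^{-s}$, $\Re s>1$. -/

import Mathlib

open Filter Topology Asymptotics

/-- The Hurwitz zeta function `ζ(s, a)` for real `a > 0` and complex `s ≠ 1`: the analytic continuation
in `s` of `∑_{n ≥ 0} (n + a)^{-s}`.  Mathlib's `HurwitzZeta.hurwitzZeta` is periodic in the parameter,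
and is `ζ(s, f)` for `f ∈ (0, 1]`.  Writing `a = f + p` with `f ∈ (0, 1]` and `p = ⌈a⌉ - 1`, one has
`ζ(s, a) = ζ(s, f) - ∑_{k < p} (a - 1 - k)^{-s}`. See `hasSum_hurwitzZetaPos` and
`differentiableAt_hurwitzZetaPos` below. -/
noncomputable def hurwitzZetaPos (s : ℂ) (a : ℝ) : ℂ :=
  HurwitzZeta.hurwitzZeta (a : UnitAddCircle) s
    - ∑ k ∈ Finset.range (⌈a⌉₊ - 1), 1 / ((a - 1 - k : ℝ) : ℂ) ^ s

/-- In the half plane `Re s > 1`, `ζ(s, a)` is given by its defining series. -/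
theorem hasSum_hurwitzZetaPos {s : ℂ} (hs : 1 < s.re) {a : ℝ} (ha : 0 < a) :
    HasSum (fun n : ℕ => 1 / ((n : ℂ) + a) ^ s) (hurwitzZetaPos s a) := by
  obtain ⟨p, hp⟩ : ∃ p, ⌈a⌉₊ = p + 1 :=
    Nat.exists_eq_succ_of_ne_zero (Nat.ceil_pos.2 ha).ne'
  have h1 : a ≤ p + 1 := by
    have := Nat.le_ceil a
    rw [hp] at this
    exact_mod_cast this
  have h2 : (p : ℝ) < a := by
    have h : p < ⌈a⌉₊ := by omega
    exact Nat.lt_ceil.1 h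
  have hf : a - p ∈ Set.Icc (0 : ℝ) 1 := ⟨by linarith, by linarith⟩
  have hc : (a : UnitAddCircle) = ((a - p : ℝ) : UnitAddCircle) := by
    have h3 : ((p : ℝ) : UnitAddCircle) = 0 :=
      (AddCircle.coe_eq_zero_iff 1).2 ⟨p, by simp⟩
    rw [AddCircle.coe_sub, h3, sub_zero]
  have hsum := HurwitzZeta.hasSum_hurwitzZeta_of_one_lt_re hf hs
  have key := (hasSum_nat_add_iff' p).2 hsum
  unfold hurwitzZetaPos
  rw [hc, hp, Nat.add_sub_cancel]
  have e1 : (fun n : ℕ => 1 / ((n : ℂ) + a) ^ s)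
      = fun n : ℕ => 1 / (((n + p : ℕ) : ℂ) + ((a - p : ℝ) : ℂ)) ^ s := by
    funext n
    congr 2
    push_cast
    ring
  have e2 : ∑ k ∈ Finset.range p, 1 / ((a - 1 - k : ℝ) : ℂ) ^ s
      = ∑ i ∈ Finset.range p, 1 / ((i : ℂ) + ((a - p : ℝ) : ℂ)) ^ s := by
    rw [← Finset.sum_range_reflect]
    refine Finset.sum_congr rfl fun k hk => ?_
    have hk' : k < p := Finset.mem_range.1 hk
    have : ((p - 1 - k : ℕ) : ℝ) = p - 1 - k := by
      rw [Nat.cast_sub (by omega), Nat.cast_sub (by omega)]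
      simp
    rw [this]
    congr 2
    push_cast
    ring
  rw [e1, e2]
  exact key

/-- `ζ(·, a)` is holomorphic on `ℂ ∖ {1}`. -/
theorem differentiableAt_hurwitzZetaPos {s : ℂ} (hs : s ≠ 1) (a : ℝ) :
    DifferentiableAt ℂ (fun z => hurwitzZetaPos z a) s := by
  unfold hurwitzZetaPos
  refine (HurwitzZeta.differentiableAt_hurwitzZeta _ hs).sub (DifferentiableAt.fun_sum fun k hk => ?_)
  have hk' : k + 1 < ⌈a⌉₊ := by
    have := Finset.mem_range.1 hk
    omega
  have h1 : ((k + 1 : ℕ) : ℝ) < a := Nat.lt_ceil.1 hk'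
  have h2 : ((a - 1 - k : ℝ) : ℂ) ≠ 0 := by
    push_cast at h1
    have : (a - 1 - k : ℝ) ≠ 0 := by linarith
    exact_mod_cast this
  have h3 : DifferentiableAt ℂ (fun z : ℂ => ((a - 1 - k : ℝ) : ℂ) ^ z) s :=
    differentiableAt_id.const_cpow (Or.inl h2)
  exact (differentiableAt_const _).div h3 fun h => h2 ((Complex.cpow_eq_zero_iff _ _).1 h).1

/-- The generating function `(t / (e^t - 1))^α e^{x t}` of the generalized Bernoulli polynomials, with
its continuous value `1` at `t = 0`. -/
noncomputable def genBernoulliFun (α x t : ℝ) : ℝ :=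
  (if t = 0 then 1 else t / (Real.exp t - 1)) ^ α * Real.exp (x * t)

/-- The generalized Bernoulli polynomial `B_n^{(α)}(x)`:
`(t / (e^t - 1))^α e^{x t} = ∑ n, B_n^{(α)}(x) t^n / n!`. -/
noncomputable def genBernoulli (n : ℕ) (α x : ℝ) : ℝ :=
  iteratedDeriv n (genBernoulliFun α x) 0

theorem analyticAt_genBernoulliFun (α x : ℝ) : AnalyticAt ℝ (genBernoulliFun α x) 0 := by
  have hd : AnalyticAt ℝ (dslope Real.exp 0) 0 := by
    obtain ⟨p, hp⟩ := (analyticAt_rexp (x := (0 : ℝ)))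
    exact ⟨_, hp.has_fpower_series_dslope_fslope⟩
  have he : genBernoulliFun α x =
      fun t => ((dslope Real.exp 0 t)⁻¹) ^ α * Real.exp (x * t) := by
    funext t
    unfold genBernoulliFun
    by_cases ht : t = 0
    · subst ht
      simp
    · rw [if_neg ht, dslope_of_ne _ ht, slope_def_field]
      simp
  rw [he]
  have hi : AnalyticAt ℝ (fun t => (dslope Real.exp 0 t)⁻¹) 0 := hd.inv (by simp)
  have hr : AnalyticAt ℝ (fun y : ℝ => y ^ α) ((dslope Real.exp 0 0)⁻¹) := by
    have hlog : AnalyticAt ℝ Real.log ((dslope Real.exp 0 0)⁻¹) :=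
      analyticAt_log (by simp)
    have hexp : AnalyticAt ℝ (fun y : ℝ => Real.exp (Real.log y * α)) ((dslope Real.exp 0 0)⁻¹) :=
      (hlog.mul analyticAt_const).rexp
    refine hexp.congr ?_
    have hpos : ∀ᶠ y : ℝ in 𝓝 ((dslope Real.exp 0 0)⁻¹), 0 < y :=
      lt_mem_nhds (by simp)
    filter_upwards [hpos] with y hy
    exact (Real.rpow_def_of_pos hy α).symm
  refine AnalyticAt.mul (AnalyticAt.fun_comp (f := fun t => (dslope Real.exp 0 t)⁻¹) hr hi) ?_
  fun_prop

/-- The defining expansion of the generalized Bernoulli polynomials, near `t = 0`. -/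
theorem hasSum_genBernoulli (α x : ℝ) :
    ∀ᶠ t in 𝓝 (0 : ℝ),
      HasSum (fun n : ℕ => t ^ n / (n.factorial : ℝ) * genBernoulli n α x) (genBernoulliFun α x t) := by
  have h := (analyticAt_genBernoulliFun α x).hasFPowerSeriesAt.eventually_hasSum
  filter_upwards [h] with t ht
  simp only [zero_add] at ht
  have e : (fun n : ℕ => t ^ n / (n.factorial : ℝ) * genBernoulli n α x)
      = fun n : ℕ => (FormalMultilinearSeries.ofScalars ℝ
          (fun n => iteratedDeriv n (genBernoulliFun α x) 0 / n.factorial) n) fun _ => t := by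
    funext n
    rw [FormalMultilinearSeries.ofScalars_apply_eq]
    simp only [genBernoulli, smul_eq_mul]
    ring
  rw [e]
  exact ht

/-- The renormalized combination of Gamma-quotient sums up to `M`. -/
noncomputable def renormalizedSum (r : ℝ) (N M : ℕ) : ℝ :=
  2 * r * (1 + r) * ∑ k ∈ Finset.Icc 1 M,
      Real.Gamma ((N : ℝ) * k + 1) / Real.Gamma ((N : ℝ) * k + 2 - r)
    + 2 * r * (1 - r) * ∑ k ∈ Finset.Icc 1 M,
      Real.Gamma ((N : ℝ) * k) / Real.Gamma ((N : ℝ) * k + 2 - r)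
    - 2 * (1 + r) * (N : ℝ) ^ (r - 1) * (M : ℝ) ^ r
    - r * (N + r + N * r - r ^ 2) * (N : ℝ) ^ (r - 2) * (M : ℝ) ^ (r - 1)

/-- The expansion with `m` terms of each of the two kinds.  Here `(x)_n`, the rising factorial, is
`(ascPochhammer ℝ n).eval x`. -/
noncomputable def zetaExpansion (r : ℝ) (m N : ℕ) : ℂ :=
  2 * r * (1 + r) * ∑ j ∈ Finset.range m,
      ((genBernoulli (2 * j) r (r / 2) * (ascPochhammer ℝ (2 * j)).eval (1 - r)
        / ((2 * j).factorial : ℝ) * (N : ℝ) ^ (r - 1 - 2 * j) : ℝ) : ℂ)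
        * hurwitzZetaPos ((1 - r + 2 * j : ℝ) : ℂ) (1 + (2 - r) / (2 * N))
    + 2 * r * (1 - r) * ∑ j ∈ Finset.range m,
      ((genBernoulli (2 * j) (r - 1) ((r - 1) / 2) * (ascPochhammer ℝ (2 * j)).eval (2 - r)
        / ((2 * j).factorial : ℝ) * (N : ℝ) ^ (r - 2 - 2 * j) : ℝ) : ℂ)
        * hurwitzZetaPos ((2 - r + 2 * j : ℝ) : ℂ) (1 + (1 - r) / (2 * N))

/-!
Write `s = 1 - r` for the first sum and `s = 2 - r` for the second.  In both, the summand is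
`Γ(w + (1 - s) / 2) / Γ(w + (1 + s) / 2)` at `w = N k + d`, with `d = (2 - r) / 2` and
`d = (1 - r) / 2` respectively, and `s > -1` because `r < 2`.

*The Gamma ratio for large `w`.*  For `s > 0` the Beta integral gives
`Γ(s)` times the ratio as the Laplace transform at `w` of
`(2 sinh (t / 2)) ^ (s - 1) = t ^ (s - 1) g(t)`, where `g` is the generating function of the numbers
`B_n^{(1 - s)}((1 - s) / 2)`.  For `-1 < s < 0` the same holds once the leading term `t ^ (s - 1)`
is split off and its transform replaced by `Γ(s) w ^ (-s)`; this is the Beta integral with `s + 1` in place of `s`, integrated by parts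
(`Gamma_mul_Gamma_div_Gamma_eq`, which covers both ranges at once).  Since `g` is even, Watson's
lemma yields an expansion in the powers `w ^ (-s - 2 j)` with an error `O(w ^ (-s - 2 m))`
(`gammaRatioRemainder_isBigO`).

*Summation over `k`.*  Along `w = N (k + d / N)` the power `w ^ (-σ)` sums to
`N ^ (-σ) ζ(σ, 1 + d / N)`.  For `σ > 1` this is the series of the Hurwitz zeta function; for
`-1 < σ < 1` the partial sums have to be corrected by the integral of `x ^ (-σ)` up to a midpoint.
The errors of the midpoint rule are `O(k ^ (-σ - 2))`, so the corrected sums converge to a function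
that is analytic for `Re σ > -1` and hence, by the identity theorem, is the analytic continuation
(`midpointZeta_eq`, `exists_tendsto_hurwitzZetaPos`).  The remainders are summable over `k`, with sum
`O(N ^ (-s - 2 m))` (`gammaRatioRemainder_sum`).  Expanding the two integral corrections, which are
powers of `M + 1 / 2 + d / N`, in powers of `M` gives exactly the terms in `M ^ r` and `M ^ (r - 1)`
that `renormalizedSum` subtracts.
-/

/-! ### The midpoint rule for complex powers -/

/-- The error of the midpoint rule is of third order: a bound on the third derivative of `f` bounds
the difference of its central difference and its derivative at the centre. -/
theorem norm_centralDiff_sub_deriv_le {f f₁ f₂ f₃ : ℝ → ℂ} {x C : ℝ}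
    (h₁ : ∀ y ∈ Set.Icc (x - 1 / 2) (x + 1 / 2), HasDerivAt f (f₁ y) y)
    (h₂ : ∀ y ∈ Set.Icc (x - 1 / 2) (x + 1 / 2), HasDerivAt f₁ (f₂ y) y)
    (h₃ : ∀ y ∈ Set.Icc (x - 1 / 2) (x + 1 / 2), HasDerivAt f₂ (f₃ y) y)
    (hC : ∀ y ∈ Set.Icc (x - 1 / 2) (x + 1 / 2), ‖f₃ y‖ ≤ C) :
    ‖f (x + 1 / 2) - f (x - 1 / 2) - f₁ x‖ ≤ C := by
  have hC0 : 0 ≤ C := (norm_nonneg _).trans (hC x ⟨by linarith, by linarith⟩)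
  have hadd {t : ℝ} (ht : t ∈ Set.Icc (0 : ℝ) (1 / 2)) :
      x + t ∈ Set.Icc (x - 1 / 2) (x + 1 / 2) := ⟨by linarith [ht.1], by linarith [ht.2]⟩
  have hsub {t : ℝ} (ht : t ∈ Set.Icc (0 : ℝ) (1 / 2)) :
      x - t ∈ Set.Icc (x - 1 / 2) (x + 1 / 2) := ⟨by linarith [ht.2], by linarith [ht.1]⟩
  have dadd {g g' : ℝ → ℂ} {t : ℝ} (hg : HasDerivAt g (g' (x + t)) (x + t)) :
      HasDerivAt (fun t => g (x + t)) (g' (x + t)) t := HasDerivAt.comp_const_add x t hg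
  have dsub {g g' : ℝ → ℂ} {t : ℝ} (hg : HasDerivAt g (g' (x - t)) (x - t)) :
      HasDerivAt (fun t => g (x - t)) (-g' (x - t)) t := HasDerivAt.comp_const_sub x t hg
  -- Three integrations from `0`: of the third, second and first derivative of the error at width `t`.
  have b₂ : ∀ t ∈ Set.Icc (0 : ℝ) (1 / 2), ‖f₂ (x + t) - f₂ (x - t)‖ ≤ C := by
    intro t ht
    have := norm_image_sub_le_of_norm_deriv_le_segment' (f := fun t => f₂ (x + t) - f₂ (x - t))
      (f' := fun t => f₃ (x + t) + f₃ (x - t)) (a := 0) (b := 1 / 2) (C := 2 * C)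
      (fun t ht => by
        simpa using ((dadd (h₃ _ (hadd ht))).fun_sub (dsub (h₃ _ (hsub ht)))).hasDerivWithinAt)
      (fun t ht => (norm_add_le _ _).trans (by
        linarith [hC _ (hadd (Set.Ico_subset_Icc_self ht)),
          hC _ (hsub (Set.Ico_subset_Icc_self ht))])) t ht
    simp only [add_zero, sub_zero, sub_self] at this
    nlinarith [ht.2]
  have b₁ : ∀ t ∈ Set.Icc (0 : ℝ) (1 / 2), ‖f₁ (x + t) + f₁ (x - t) - 2 * f₁ x‖ ≤ C := by
    intro t ht
    have := norm_image_sub_le_of_norm_deriv_le_segment' (f := fun t => f₁ (x + t) + f₁ (x - t))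
      (f' := fun t => f₂ (x + t) - f₂ (x - t)) (a := 0) (b := 1 / 2) (C := C)
      (fun t ht => by
        simpa [sub_eq_add_neg] using
          ((dadd (h₂ _ (hadd ht))).fun_add (dsub (h₂ _ (hsub ht)))).hasDerivWithinAt)
      (fun t ht => b₂ t (Set.Ico_subset_Icc_self ht)) t ht
    simp only [add_zero, sub_zero] at this
    rw [two_mul]
    nlinarith [ht.2]
  have := norm_image_sub_le_of_norm_deriv_le_segment'
    (f := fun t : ℝ => f (x + t) - f (x - t) - t * (2 * f₁ x))
    (f' := fun t => f₁ (x + t) + f₁ (x - t) - 2 * f₁ x) (a := 0) (b := 1 / 2) (C := C)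
    (fun t ht => by
      have h := ((dadd (h₁ _ (hadd ht))).fun_sub (dsub (h₁ _ (hsub ht)))).fun_sub
        ((Complex.ofRealCLM.hasDerivAt (x := t)).mul_const (2 * f₁ x))
      simpa [sub_eq_add_neg] using h.hasDerivWithinAt)
    (fun t ht => b₁ t (Set.Ico_subset_Icc_self ht)) (1 / 2) ⟨by norm_num, le_rfl⟩
  have e : f (x + 1 / 2) - f (x - 1 / 2) - ((1 / 2 : ℝ) : ℂ) * (2 * f₁ x)
      = f (x + 1 / 2) - f (x - 1 / 2) - f₁ x := by
    push_cast; ring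
  simp only [e, add_zero, sub_zero, sub_self, Complex.ofReal_zero, zero_mul] at this
  linarith

/-- `s - 1` times the difference of `(k + a)^{-s}` and the integral of `x^{-s}` over the interval of
length `1` with centre `k + a`; it is entire in `s`. -/
noncomputable def midpointError (a : ℝ) (k : ℕ) (s : ℂ) : ℂ :=
  (((k + a + 1 / 2 : ℝ) : ℂ) ^ (1 - s) - ((k + a - 1 / 2 : ℝ) : ℂ) ^ (1 - s))
    - (1 - s) * ((k + a : ℝ) : ℂ) ^ (-s)

theorem norm_midpointError_le {a : ℝ} (ha : 1 / 2 ≤ a) {k : ℕ} (hk : 1 ≤ k) {s : ℂ} {R δ : ℝ}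
    (hR : ‖s‖ ≤ R) (hδ : δ ≤ s.re) (hδ1 : -1 ≤ δ) :
    ‖midpointError a k s‖ ≤ (1 + R) ^ 3 * (k : ℝ) ^ (-δ - 2) := by
  have hk' : (1 : ℝ) ≤ k := by exact_mod_cast hk
  have hd (c : ℂ) {y : ℝ} (hy : 0 < y) :
      HasDerivAt (fun y : ℝ => (y : ℂ) ^ c) (c * (y : ℂ) ^ (c - 1)) y := by
    simpa using ((hasDerivAt_id (y : ℂ)).cpow_const (c := c) (Or.inl (by simpa using hy))).comp_ofReal
  have hy {y : ℝ} (h : y ∈ Set.Icc ((k + a : ℝ) - 1 / 2) (k + a + 1 / 2)) : (k : ℝ) ≤ y := by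
    linarith [h.1]
  have hp {y : ℝ} (h : y ∈ Set.Icc ((k + a : ℝ) - 1 / 2) (k + a + 1 / 2)) : 0 < y := by
    linarith [hy h]
  refine norm_centralDiff_sub_deriv_le (f := fun y : ℝ => (y : ℂ) ^ (1 - s))
    (f₁ := fun y : ℝ => (1 - s) * (y : ℂ) ^ (-s))
    (f₂ := fun y : ℝ => (1 - s) * (-s * (y : ℂ) ^ (-s - 1)))
    (f₃ := fun y : ℝ => (1 - s) * (-s * ((-s - 1) * (y : ℂ) ^ (-s - 1 - 1)))) ?_ ?_ ?_ ?_
  · intro y h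
    simpa [show 1 - s - 1 = -s by ring] using hd (1 - s) (hp h)
  · exact fun y h => (hd (-s) (hp h)).const_mul _
  · exact fun y h => ((hd (-s - 1) (hp h)).const_mul _).const_mul _
  · intro y h
    have h1 : ‖1 - s‖ ≤ 1 + R := (norm_sub_le _ _).trans (by simpa using hR)
    have h2 : ‖-s‖ ≤ 1 + R := by rw [norm_neg]; linarith
    have h3 : ‖-s - 1‖ ≤ 1 + R := (norm_sub_le _ _).trans (by rw [norm_neg, norm_one]; linarith)
    have h4 : ‖(y : ℂ) ^ (-s - 1 - 1)‖ ≤ (k : ℝ) ^ (-δ - 2) := by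
      rw [Complex.norm_cpow_eq_rpow_re_of_pos (hp h)]
      have : (-s - 1 - 1).re = -s.re - 2 := by simp; ring
      rw [this]
      calc y ^ (-s.re - 2) ≤ (k : ℝ) ^ (-s.re - 2) :=
            Real.rpow_le_rpow_of_nonpos (by linarith) (hy h) (by linarith)
        _ ≤ (k : ℝ) ^ (-δ - 2) := Real.rpow_le_rpow_of_exponent_le hk' (by linarith)
    have hR0 : 0 ≤ 1 + R := (norm_nonneg _).trans h1
    rw [norm_mul, norm_mul, norm_mul]
    calc _ ≤ (1 + R) * ((1 + R) * ((1 + R) * (k : ℝ) ^ (-δ - 2))) := by gcongr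
      _ = _ := by ring

theorem summable_midpointError_bound {δ : ℝ} (hδ : -1 < δ) (R : ℝ) :
    Summable fun k : ℕ => (1 + R) ^ 3 * ((k + 1 : ℕ) : ℝ) ^ (-δ - 2) :=
  (((summable_nat_add_iff 1).2 (Real.summable_nat_rpow.2 (by linarith)))).mul_left _

/-- The analytic continuation of `(s - 1) ζ(s, a)` to `Re s > -1` given by the midpoint rule.  The
term of index `0` is kept apart so that the midpoint errors are taken away from the origin. -/
noncomputable def midpointZeta (a : ℝ) (s : ℂ) : ℂ :=
  (s - 1) * (a : ℂ) ^ (-s) + ((a + 1 / 2 : ℝ) : ℂ) ^ (1 - s) + ∑' k : ℕ, midpointError a (k + 1) s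

theorem tendsto_midpointZeta {a : ℝ} (ha : 1 / 2 ≤ a) {s : ℂ} (hs : -1 < s.re) :
    Tendsto (fun M : ℕ => (s - 1) * ∑ k ∈ Finset.range M, ((k + a : ℝ) : ℂ) ^ (-s)
      + ((M + a - 1 / 2 : ℝ) : ℂ) ^ (1 - s)) atTop (𝓝 (midpointZeta a s)) := by
  have hsum : Summable fun k : ℕ => midpointError a (k + 1) s :=
    Summable.of_norm_bounded (summable_midpointError_bound hs ‖s‖)
      fun k => norm_midpointError_le ha (by omega) le_rfl le_rfl hs.le
  rw [← tendsto_add_atTop_iff_nat 1]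
  refine (hsum.hasSum.tendsto_sum_nat.const_add
    ((s - 1) * (a : ℂ) ^ (-s) + ((a + 1 / 2 : ℝ) : ℂ) ^ (1 - s))).congr fun M => ?_
  induction M with
  | zero => simp; congr 1; ring
  | succ M ih =>
    rw [Finset.sum_range_succ, ← add_assoc, ih, Finset.sum_range_succ _ (M + 1), midpointError]
    have : ((M + 1 : ℕ) : ℝ) + a + 1 / 2 = ((M + 1 + 1 : ℕ) : ℝ) + a - 1 / 2 := by push_cast; ring
    rw [this]
    ring

theorem differentiableAt_midpointZeta {a : ℝ} (ha : 1 / 2 ≤ a) {s : ℂ} (hs : -1 < s.re) :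
    DifferentiableAt ℂ (midpointZeta a) s := by
  obtain ⟨δ, hδ, hδs⟩ := exists_between hs
  have hc {x : ℝ} (hx : 0 < x) {f : ℂ → ℂ} (hf : Differentiable ℂ f) :
      Differentiable ℂ fun s => (x : ℂ) ^ f s :=
    fun s => (hf s).const_cpow (Or.inl (by exact_mod_cast hx.ne'))
  have hU : IsOpen ({z : ℂ | δ < z.re} ∩ Metric.ball 0 (‖s‖ + 1)) :=
    (isOpen_lt continuous_const Complex.continuous_re).inter Metric.isOpen_ball
  have ht := Complex.differentiableOn_tsum_of_summable_norm (F := fun k z => midpointError a (k + 1) z)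
    (summable_midpointError_bound hδ (‖s‖ + 1))
    (fun k => by
      have h0 : (0 : ℝ) < (k + 1 : ℕ) := by positivity
      refine Differentiable.differentiableOn ?_
      unfold midpointError
      refine ((hc (by linarith) (by fun_prop)).sub (hc (by linarith) (by fun_prop))).sub
        (Differentiable.mul (by fun_prop) (hc (by linarith) (by fun_prop)))) hU
    (fun k z hz => norm_midpointError_le ha (by omega)
      (by simpa using (Metric.mem_ball.1 hz.2).le) (le_of_lt hz.1) hδ.le)
  have hts := ht.differentiableAt (hU.mem_nhds (x := s) ⟨hδs, by simp⟩)
  unfold midpointZeta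
  refine DifferentiableAt.add ?_ hts
  exact ((Differentiable.mul (by fun_prop) (hc (by linarith) (by fun_prop))).add
    (hc (by linarith) (by fun_prop))) s

/-! ### The Hurwitz zeta function as a renormalized sum -/

theorem midpointZeta_eq_of_one_lt_re {a : ℝ} (ha : 1 / 2 ≤ a) {s : ℂ} (hs : 1 < s.re) :
    midpointZeta a s = (s - 1) * hurwitzZetaPos s a := by
  refine tendsto_nhds_unique (tendsto_midpointZeta ha (by linarith)) ?_
  have h1 := ((hasSum_hurwitzZetaPos hs (a := a) (by linarith)).tendsto_sum_nat).const_mul (s - 1)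
  have h2 : Tendsto (fun M : ℕ => ((M + a - 1 / 2 : ℝ) : ℂ) ^ (1 - s)) atTop (𝓝 0) := by
    rw [tendsto_zero_iff_norm_tendsto_zero]
    have h3 : Tendsto (fun M : ℕ => (M : ℝ) + a - 1 / 2) atTop atTop := by
      simp_rw [add_sub_assoc]
      exact tendsto_atTop_add_const_right _ _ tendsto_natCast_atTop_atTop
    have h4 := (tendsto_rpow_neg_atTop (y := s.re - 1) (by linarith)).comp h3
    refine h4.congr' ?_
    filter_upwards [h3.eventually_gt_atTop 0] with M hM
    rw [Complex.norm_cpow_eq_rpow_re_of_pos hM]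
    simp
  simpa [Complex.cpow_neg] using h1.add h2

/-- The half plane `Re s > -1` stays connected when `1` is removed: what remains is the union of four
convex sets, namely its upper and lower parts, the half plane `Re s > 1` and the strip
`-1 < Re s < 1`. -/
theorem isPreconnected_halfPlane_diff_one :
    IsPreconnected ({s : ℂ | -1 < s.re} \ {1}) := by
  have cre (x : ℝ) : Convex ℝ {s : ℂ | x < s.re} := convex_halfSpace_re_gt x
  have hA : IsPreconnected ({s : ℂ | -1 < s.re} ∩ {s | 0 < s.im}) :=
    ((cre _).inter (convex_halfSpace_im_gt 0)).isPreconnected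
  have hC : IsPreconnected ({s : ℂ | -1 < s.re} ∩ {s | s.im < 0}) :=
    ((cre _).inter (convex_halfSpace_im_lt 0)).isPreconnected
  have hD : IsPreconnected ({s : ℂ | -1 < s.re} ∩ {s | s.re < 1}) :=
    ((cre _).inter (convex_halfSpace_re_lt 1)).isPreconnected
  have hB : IsPreconnected {s : ℂ | 1 < s.re} := (cre 1).isPreconnected
  have h1 := hA.union' ⟨⟨2, 1⟩, by norm_num⟩ hB
  have h2 := h1.union' ⟨⟨2, -1⟩, by norm_num⟩ hC
  have h3 := h2.union' ⟨⟨0, 1⟩, by norm_num⟩ hD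
  convert h3 using 1
  ext s
  simp only [Set.mem_sdiff, Set.mem_union, Set.mem_inter_iff, Set.mem_ofPred_eq,
    Set.mem_singleton_iff, Complex.ext_iff, Complex.one_re, Complex.one_im]
  constructor
  · rintro ⟨h, h'⟩
    rcases lt_trichotomy s.re 1 with h4 | h4 | h4
    · simp [h, h4]
    · rcases lt_trichotomy s.im 0 with h5 | h5 | h5
      · simp [h, h5]
      · exact absurd ⟨h4, h5⟩ h'
      · simp [h, h5]
    · simp [h4]
  · rintro (((h | h) | h) | h)
    · exact ⟨h.1, fun h' => by linarith [h.2, h'.2]⟩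
    · exact ⟨by linarith, fun h' => by linarith [h'.1]⟩
    · exact ⟨h.1, fun h' => by linarith [h.2, h'.2]⟩
    · exact ⟨h.1, fun h' => by linarith [h.2, h'.1]⟩

theorem midpointZeta_eq {a : ℝ} (ha : 1 / 2 ≤ a) {s : ℂ} (hs : -1 < s.re) (hs1 : s ≠ 1) :
    midpointZeta a s = (s - 1) * hurwitzZetaPos s a := by
  have hU : IsOpen ({s : ℂ | -1 < s.re} \ {1}) :=
    (isOpen_lt continuous_const Complex.continuous_re).sdiff isClosed_singleton
  have h1 : AnalyticOnNhd ℂ (midpointZeta a) ({s : ℂ | -1 < s.re} \ {1}) :=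
    DifferentiableOn.analyticOnNhd
      (fun z hz => (differentiableAt_midpointZeta ha hz.1).differentiableWithinAt) hU
  have h2 : AnalyticOnNhd ℂ (fun s => (s - 1) * hurwitzZetaPos s a) ({s : ℂ | -1 < s.re} \ {1}) :=
    DifferentiableOn.analyticOnNhd
      (fun z hz => (DifferentiableAt.mul (by fun_prop)
        (differentiableAt_hurwitzZetaPos hz.2 a)).differentiableWithinAt) hU
  refine h1.eqOn_of_preconnected_of_eventuallyEq h2 isPreconnected_halfPlane_diff_one
    (z₀ := 2) ⟨by norm_num, by norm_num⟩ ?_ ⟨hs, hs1⟩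
  filter_upwards [(isOpen_lt continuous_const Complex.continuous_re).mem_nhds
    (show (2 : ℂ) ∈ {s : ℂ | 1 < s.re} by norm_num)] with z hz
  exact midpointZeta_eq_of_one_lt_re ha hz

/-- For real `σ > -1` the partial sums of `∑ (k + a)^{-σ}`, corrected by the integral of `x^{-σ}` up
to the midpoint `M + a - 1/2`, converge to the Hurwitz zeta value, which is therefore real. -/
theorem exists_tendsto_hurwitzZetaPos {a σ : ℝ} (ha : 1 / 2 ≤ a) (hσ : -1 < σ) (hσ1 : σ ≠ 1) :
    ∃ z : ℝ, hurwitzZetaPos (σ : ℂ) a = z ∧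
      Tendsto (fun M : ℕ => ∑ k ∈ Finset.range M, ((k : ℝ) + a) ^ (-σ)
        - ((M : ℝ) + a - 1 / 2) ^ (1 - σ) / (1 - σ)) atTop (𝓝 z) := by
  have hσ1' : (σ : ℂ) - 1 ≠ 0 := sub_ne_zero.2 (by exact_mod_cast hσ1)
  have h := tendsto_midpointZeta ha (s := (σ : ℂ)) (by simpa using hσ)
  rw [midpointZeta_eq ha (by simpa using hσ) (by exact_mod_cast hσ1)] at h
  have h2 := h.const_mul ((σ : ℂ) - 1)⁻¹
  rw [inv_mul_cancel_left₀ hσ1'] at h2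
  have h3 : Tendsto (fun M : ℕ => ((∑ k ∈ Finset.range M, ((k : ℝ) + a) ^ (-σ)
        - ((M : ℝ) + a - 1 / 2) ^ (1 - σ) / (1 - σ) : ℝ) : ℂ)) atTop
        (𝓝 (hurwitzZetaPos (σ : ℂ) a)) := by
    refine h2.congr' ?_
    filter_upwards [eventually_ge_atTop 1] with M hM
    have hM' : (1 : ℝ) ≤ M := by exact_mod_cast hM
    have e1 : ∑ k ∈ Finset.range M, ((k + a : ℝ) : ℂ) ^ (-(σ : ℂ))
        = ((∑ k ∈ Finset.range M, ((k : ℝ) + a) ^ (-σ) : ℝ) : ℂ) := by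
      rw [Complex.ofReal_sum]
      refine Finset.sum_congr rfl fun k _ => ?_
      rw [Complex.ofReal_cpow (by positivity), Complex.ofReal_neg]
    have e2 : ((M + a - 1 / 2 : ℝ) : ℂ) ^ (1 - (σ : ℂ))
        = (((M : ℝ) + a - 1 / 2) ^ (1 - σ) : ℝ) := by
      rw [Complex.ofReal_cpow (by linarith)]
      push_cast
      rfl
    have e3 : (((1 - σ : ℝ)) : ℂ) = -((σ : ℂ) - 1) := by push_cast; ring
    rw [e1, e2, mul_add, inv_mul_cancel_left₀ hσ1', Complex.ofReal_sub, Complex.ofReal_div, e3,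
      div_neg, sub_neg_eq_add, div_eq_inv_mul _ ((σ : ℂ) - 1)]
  refine ⟨(hurwitzZetaPos (σ : ℂ) a).re, ?_, ?_⟩
  · refine Complex.ext rfl ?_
    have := (Complex.continuous_im.tendsto _).comp h3
    refine tendsto_nhds_unique this ?_
    simp only [Function.comp_def, Complex.ofReal_im]
    exact tendsto_const_nhds
  · exact (Complex.continuous_re.tendsto _).comp h3

/-! ### The generating function of the generalized Bernoulli polynomials -/

theorem genBernoulliFun_of_pos {t : ℝ} (ht : 0 < t) (α x : ℝ) :
    genBernoulliFun α x t = (t / (Real.exp t - 1)) ^ α * Real.exp (x * t) := by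
  rw [genBernoulliFun, if_neg ht.ne']

@[simp] theorem genBernoulliFun_zero (α x : ℝ) : genBernoulliFun α x 0 = 1 := by
  simp [genBernoulliFun]

theorem measurable_genBernoulliFun (α x : ℝ) : Measurable (genBernoulliFun α x) :=
  ((Measurable.ite (measurableSet_singleton 0) measurable_const (by fun_prop)).pow_const α).mul
    (by fun_prop)

/-- Centring the exponent at `α / 2` makes the generating function `(t / (2 sinh (t / 2))) ^ α`,
which is even. -/
theorem genBernoulliFun_half_neg (α t : ℝ) :
    genBernoulliFun α (α / 2) (-t) = genBernoulliFun α (α / 2) t := by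
  wlog ht : 0 < t generalizing t
  · rcases (not_lt.1 ht).eq_or_lt with h | h
    · simp [h]
    · simpa using (this (-t) (by linarith)).symm
  have h1 : 0 < Real.exp t - 1 := by linarith [Real.add_one_lt_exp ht.ne']
  have h2 : -t / (Real.exp (-t) - 1) = t / (Real.exp t - 1) * Real.exp t := by
    have h3 : Real.exp (-t) - 1 ≠ 0 := by
      have : Real.exp (-t) < 1 := by simpa using ht
      linarith
    rw [Real.exp_neg] at h3 ⊢
    have := Real.exp_pos t
    have h4 : (Real.exp t)⁻¹ - 1 = -(Real.exp t - 1) * (Real.exp t)⁻¹ := by field_simp; ring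
    rw [h4]
    field_simp
  rw [genBernoulliFun_of_pos ht, genBernoulliFun, if_neg (by linarith), h2,
    Real.mul_rpow (by positivity) (Real.exp_pos t).le, ← Real.exp_mul, mul_assoc, ← Real.exp_add]
  ring_nf

theorem genBernoulli_zero (α x : ℝ) : genBernoulli 0 α x = 1 := by
  simp [genBernoulli]

theorem genBernoulli_half_of_odd (α : ℝ) {n : ℕ} (hn : Odd n) : genBernoulli n α (α / 2) = 0 := by
  have h := iteratedDeriv_comp_neg n (genBernoulliFun α (α / 2)) 0
  simp only [genBernoulliFun_half_neg, hn.neg_one_pow, neg_zero, smul_eq_mul] at h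
  change iteratedDeriv n (genBernoulliFun α (α / 2)) 0 = 0
  linarith

theorem abs_genBernoulliFun_le {t : ℝ} (ht : 0 < t) (α x : ℝ) :
    |genBernoulliFun α x t| ≤ Real.exp ((|α| + |x|) * t) := by
  have h1 : 0 < Real.exp t - 1 := by linarith [Real.add_one_lt_exp ht.ne']
  have hq : 0 < t / (Real.exp t - 1) := by positivity
  have hq1 : t / (Real.exp t - 1) ≤ 1 := by
    rw [div_le_one h1]; linarith [Real.add_one_le_exp t]
  have hq2 : Real.exp (-t) ≤ t / (Real.exp t - 1) := by
    rw [le_div_iff₀ h1, mul_sub, ← Real.exp_add]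
    have := Real.add_one_le_exp (-t)
    simp; linarith
  rw [genBernoulliFun_of_pos ht, abs_of_pos (by positivity), add_mul, Real.exp_add]
  refine mul_le_mul ?_ (Real.exp_le_exp.2 ?_) (Real.exp_pos _).le (Real.exp_pos _).le
  · rw [Real.rpow_def_of_pos hq]
    refine Real.exp_le_exp.2 ?_
    have l1 : Real.log (t / (Real.exp t - 1)) ≤ 0 := Real.log_nonpos hq.le hq1
    have l2 : -t ≤ Real.log (t / (Real.exp t - 1)) := (Real.le_log_iff_exp_le hq).2 hq2
    have l3 : |Real.log (t / (Real.exp t - 1))| ≤ t := abs_le.2 ⟨l2, by linarith⟩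
    calc _ ≤ |Real.log (t / (Real.exp t - 1)) * α| := le_abs_self _
      _ = |Real.log (t / (Real.exp t - 1))| * |α| := abs_mul _ _
      _ ≤ t * |α| := by gcongr
      _ = |α| * t := mul_comm _ _
  · exact mul_le_mul_of_nonneg_right (le_abs_self x) ht.le

/-- The remainder of the Taylor expansion of `(t / (2 sinh (t / 2))) ^ α`, with `m` terms of even
order. -/
noncomputable def evenTaylorRemainder (α : ℝ) (m : ℕ) (t : ℝ) : ℝ :=
  genBernoulliFun α (α / 2) t
    - ∑ j ∈ Finset.range m, genBernoulli (2 * j) α (α / 2) / ((2 * j).factorial : ℝ) * t ^ (2 * j)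

theorem measurable_evenTaylorRemainder (α : ℝ) (m : ℕ) : Measurable (evenTaylorRemainder α m) :=
  (measurable_genBernoulliFun _ _).sub (by fun_prop)

theorem evenTaylorRemainder_isBigO (α : ℝ) (m : ℕ) :
    evenTaylorRemainder α m =O[𝓝 0] fun t => t ^ (2 * m) := by
  have h := (analyticAt_genBernoulliFun α (α / 2)).hasFPowerSeriesAt.isBigO_sub_partialSum_pow (2 * m)
  have h2 : (fun t : ℝ => t ^ (2 * m)) = fun t => ‖t‖ ^ (2 * m) := by
    funext t; simp [pow_mul]
  rw [h2]
  refine h.congr_left fun t => ?_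
  rw [evenTaylorRemainder, zero_add]
  congr 1
  rw [FormalMultilinearSeries.partialSum]
  induction m with
  | zero => simp
  | succ m ih =>
    rw [show 2 * (m + 1) = 2 * m + 1 + 1 by ring, Finset.sum_range_succ, Finset.sum_range_succ,
      Finset.sum_range_succ _ m, ih, add_assoc]
    · congr 1
      have := genBernoulli_half_of_odd α (n := 2 * m + 1) ⟨m, rfl⟩
      rw [genBernoulli] at this
      rw [FormalMultilinearSeries.ofScalars_apply_eq, FormalMultilinearSeries.ofScalars_apply_eq,
        this]
      simp [genBernoulli]
    · exact (analyticAt_genBernoulliFun α (α / 2)).hasFPowerSeriesAt.isBigO_sub_partialSum_pow _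
    · funext t; simp [pow_mul]

/-- The Taylor remainder is controlled on the whole half line, at the cost of an exponential
factor. -/
theorem exists_abs_evenTaylorRemainder_le (α : ℝ) (m : ℕ) :
    ∃ C c : ℝ, ∀ t : ℝ, 0 < t → |evenTaylorRemainder α m t| ≤ C * t ^ (2 * m) * Real.exp (c * t) := by
  obtain ⟨K, hK⟩ := (evenTaylorRemainder_isBigO α m).bound
  obtain ⟨δ, hδ, hball⟩ := Metric.eventually_nhds_iff.1 hK
  set c := |α| + |α / 2| with hc
  have hc0 : 0 ≤ c := by positivity
  set S := ∑ j ∈ Finset.range m, |genBernoulli (2 * j) α (α / 2) / ((2 * j).factorial : ℝ)|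
    * (δ ^ (2 * (m - j)))⁻¹ with hS
  have hS0 : 0 ≤ S := Finset.sum_nonneg fun j _ => by positivity
  -- `K` serves for `t < δ`; for `t ≥ δ` the other two constants bound the generating function and
  -- the Taylor polynomial, each lower power of `t` being compared with `t ^ (2 * m)`.
  refine ⟨|K| + (δ ^ (2 * m))⁻¹ + S, c, fun t ht => ?_⟩
  have he1 : 1 ≤ Real.exp (c * t) := Real.one_le_exp (by positivity)
  rcases lt_or_ge t δ with h | h
  · have h1 := hball (y := t) (by simpa [abs_of_pos ht] using h)
    rw [Real.norm_eq_abs, Real.norm_eq_abs, abs_of_pos (show (0 : ℝ) < t ^ (2 * m) by positivity)] at h1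
    have h0 : 0 ≤ (δ ^ (2 * m))⁻¹ := by positivity
    calc _ ≤ K * t ^ (2 * m) := h1
      _ ≤ (|K| + (δ ^ (2 * m))⁻¹ + S) * t ^ (2 * m) * 1 := by
        rw [mul_one]; gcongr; linarith [le_abs_self K]
      _ ≤ _ := by gcongr
  · have hpow (i : ℕ) (hi : i ≤ m) : t ^ (2 * i) ≤ (δ ^ (2 * (m - i)))⁻¹ * t ^ (2 * m) := by
      rw [inv_mul_eq_div, le_div_iff₀ (by positivity)]
      calc t ^ (2 * i) * δ ^ (2 * (m - i)) ≤ t ^ (2 * i) * t ^ (2 * (m - i)) := by gcongr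
        _ = t ^ (2 * m) := by rw [← pow_add]; congr 1; omega
    have h1 : |genBernoulliFun α (α / 2) t| ≤ (δ ^ (2 * m))⁻¹ * t ^ (2 * m) * Real.exp (c * t) := by
      refine (abs_genBernoulliFun_le ht α (α / 2)).trans ?_
      have := hpow 0 (by omega)
      simp only [mul_zero, pow_zero, Nat.sub_zero] at this
      exact le_mul_of_one_le_left (Real.exp_pos _).le this
    have h2 : |∑ j ∈ Finset.range m,
        genBernoulli (2 * j) α (α / 2) / ((2 * j).factorial : ℝ) * t ^ (2 * j)|
        ≤ S * t ^ (2 * m) := by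
      refine (Finset.abs_sum_le_sum_abs _ _).trans ?_
      rw [hS, Finset.sum_mul]
      refine Finset.sum_le_sum fun j hj => ?_
      rw [abs_mul, abs_of_pos (show (0 : ℝ) < t ^ (2 * j) by positivity), mul_assoc]
      exact mul_le_mul_of_nonneg_left (hpow j (Finset.mem_range.1 hj).le) (abs_nonneg _)
    have h3 : S * t ^ (2 * m) ≤ S * t ^ (2 * m) * Real.exp (c * t) :=
      le_mul_of_one_le_right (by positivity) he1
    have h4 : 0 ≤ |K| * t ^ (2 * m) * Real.exp (c * t) := by positivity
    refine (abs_sub _ _).trans ?_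
    nlinarith

/-! ### The ratio of two Gamma values as a Laplace transform -/

open MeasureTheory in
theorem betaIntegral_exp_substitution {u v : ℝ} (hu : 0 < u) (hv : 0 < v) :
    IntegrableOn (fun t : ℝ => Real.exp (-(u * t)) * (1 - Real.exp (-t)) ^ (v - 1)) (Set.Ioi 0) ∧
      ∫ t in Set.Ioi (0 : ℝ), Real.exp (-(u * t)) * (1 - Real.exp (-t)) ^ (v - 1)
        = Real.Gamma u * Real.Gamma v / Real.Gamma (u + v) := by
  have himg : (fun t : ℝ => Real.exp (-t)) '' Set.Ioi 0 = Set.Ioo 0 1 := by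
    ext x
    simp only [Set.mem_image, Set.mem_Ioi, Set.mem_Ioo]
    constructor
    · rintro ⟨t, ht, rfl⟩
      exact ⟨Real.exp_pos _, by simpa using ht⟩
    · rintro ⟨h0, h1⟩
      exact ⟨-Real.log x, by linarith [Real.log_neg h0 h1], by simp [Real.exp_log h0]⟩
  have hder : ∀ t ∈ Set.Ioi (0 : ℝ),
      HasDerivWithinAt (fun t : ℝ => Real.exp (-t)) (-Real.exp (-t)) (Set.Ioi 0) t := fun t _ => by
    simpa using ((hasDerivAt_neg t).exp).hasDerivWithinAt
  have hinj : Set.InjOn (fun t : ℝ => Real.exp (-t)) (Set.Ioi 0) := fun x _ y _ h => by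
    simpa using h
  have hre : ∀ x ∈ Set.Ioo (0 : ℝ) 1, (x : ℂ) ^ ((u : ℂ) - 1) * (1 - (x : ℂ)) ^ ((v : ℂ) - 1)
      = ((x ^ (u - 1) * (1 - x) ^ (v - 1) : ℝ) : ℂ) := fun x hx => by
    push_cast [Complex.ofReal_cpow hx.1.le, Complex.ofReal_cpow (show 0 ≤ 1 - x by linarith [hx.2])]
    rfl
  have hcongr : Set.EqOn (fun t : ℝ => |-Real.exp (-t)| •
      (Real.exp (-t) ^ (u - 1) * (1 - Real.exp (-t)) ^ (v - 1)))
      (fun t : ℝ => Real.exp (-(u * t)) * (1 - Real.exp (-t)) ^ (v - 1)) (Set.Ioi 0) := fun t _ => by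
    simp only [abs_neg, Real.abs_exp, smul_eq_mul]
    rw [← mul_assoc, ← Real.exp_mul, ← Real.exp_add]
    ring_nf
  have hint := Complex.betaIntegral_convergent (u := u) (v := v) (by simpa) (by simpa)
  rw [intervalIntegrable_iff_integrableOn_Ioo_of_le zero_le_one,
    integrableOn_congr_fun hre measurableSet_Ioo] at hint
  have hint' : IntegrableOn (fun x : ℝ => x ^ (u - 1) * (1 - x) ^ (v - 1)) (Set.Ioo 0 1) := hint.re
  have hval := Complex.betaIntegral_eq_Gamma_mul_div u v (by simpa) (by simpa)
  rw [Complex.betaIntegral, intervalIntegral.integral_of_le zero_le_one, integral_Ioc_eq_integral_Ioo,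
    setIntegral_congr_fun measurableSet_Ioo hre, integral_complex_ofReal, ← Complex.ofReal_add,
    Complex.Gamma_ofReal, Complex.Gamma_ofReal, Complex.Gamma_ofReal] at hval
  constructor
  · rw [← integrableOn_congr_fun hcongr measurableSet_Ioi]
    refine (integrableOn_image_iff_integrableOn_abs_deriv_smul measurableSet_Ioi hder hinj
      (fun x => x ^ (u - 1) * (1 - x) ^ (v - 1))).1 ?_
    rwa [himg]
  · rw [← setIntegral_congr_fun measurableSet_Ioi hcongr,
      ← integral_image_eq_integral_abs_deriv_smul measurableSet_Ioi hder hinj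
        (fun x => x ^ (u - 1) * (1 - x) ^ (v - 1)), himg]
    exact_mod_cast hval

open MeasureTheory in
theorem integrableOn_rpow_mul_exp_neg_mul {a w : ℝ} (ha : 0 < a) (hw : 0 < w) :
    IntegrableOn (fun t : ℝ => t ^ (a - 1) * Real.exp (-(w * t))) (Set.Ioi 0) := by
  simpa using integrableOn_rpow_mul_exp_neg_mul_rpow (p := 1) (s := a - 1) (by linarith) one_pos hw

/-- For `s > -1` the ratio of Gamma values is the Laplace transform of `t ^ (s - 1)` times the
generating function, divided by `Γ(s)`, the leading term being regularized when `s < 0`. -/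
theorem Gamma_mul_Gamma_div_Gamma_eq {s w : ℝ} (hs : -1 < s) (hs0 : s ≠ 0) (hw : 0 < w)
    (hws : 0 < w + (1 - s) / 2)
    (hint : MeasureTheory.IntegrableOn (fun t : ℝ => t ^ (s - 1) * Real.exp (-(w * t))
      * evenTaylorRemainder (1 - s) 1 t) (Set.Ioi 0)) :
    Real.Gamma s * (Real.Gamma (w + (1 - s) / 2) / Real.Gamma (w + (1 + s) / 2))
      = Real.Gamma s * w ^ (-s) + ∫ t in Set.Ioi (0 : ℝ), t ^ (s - 1) * Real.exp (-(w * t))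
        * evenTaylorRemainder (1 - s) 1 t := by
  set u := w + (1 - s) / 2 with hu
  set l := w + (1 + s) / 2 with hl
  have hl0 : 0 < l := by rw [hl]; linarith
  have hexp {t : ℝ} (ht : 0 < t) : 0 < Real.exp t - 1 := by linarith [Real.add_one_lt_exp ht.ne']
  obtain ⟨hA, hA'⟩ := betaIntegral_exp_substitution hws (v := s + 1) (by linarith)
  simp only [add_sub_cancel_right] at hA hA'
  have hAeq : Set.EqOn (fun t : ℝ => Real.exp (-(u * t)) * (1 - Real.exp (-t)) ^ s)
      (fun t => Real.exp (-(l * t)) * (Real.exp t - 1) ^ s) (Set.Ioi 0) := fun t ht => by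
    have : 1 - Real.exp (-t) = (Real.exp t - 1) * Real.exp (-t) := by
      rw [sub_mul, ← Real.exp_add]; simp
    simp only
    rw [this, Real.mul_rpow (hexp ht).le (Real.exp_pos _).le, ← Real.exp_mul, mul_left_comm,
      ← Real.exp_add, mul_comm]
    congr 2
    rw [hu, hl]; ring
  rw [MeasureTheory.integrableOn_congr_fun hAeq measurableSet_Ioi] at hA
  rw [MeasureTheory.setIntegral_congr_fun measurableSet_Ioi hAeq] at hA'
  have hB := integrableOn_rpow_mul_exp_neg_mul (a := s + 1) (by linarith) hw
  have hB' := Real.integral_rpow_mul_exp_neg_mul_Ioi (a := s + 1) (by linarith) hw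
  simp only [add_sub_cancel_right] at hB hB'
  -- A primitive of the regularized integrand; since `s ≠ 0`, its value at `0` is `0`.
  set F : ℝ → ℝ := fun t => Real.exp (-(l * t)) * (Real.exp t - 1) ^ s - t ^ s * Real.exp (-(w * t))
    with hF
  have hF0 : F 0 = 0 := by simp [hF, Real.zero_rpow hs0]
  have hcont : ContinuousWithinAt F (Set.Ici 0) 0 := by
    rw [← continuousWithinAt_Ioi_iff_Ici, ContinuousWithinAt, hF0]
    have hD : AnalyticAt ℝ (fun t => genBernoulliFun (-s) (-l) t - Real.exp (-(w * t))) 0 :=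
      (analyticAt_genBernoulliFun (-s) (-l)).sub (by fun_prop)
    have hO := hD.differentiableAt.isBigO_sub
    simp only [genBernoulliFun_zero, mul_zero, neg_zero, Real.exp_zero, sub_self, sub_zero] at hO
    have h1 : F =ᶠ[𝓝[>] 0] fun t => t ^ s * (genBernoulliFun (-s) (-l) t - Real.exp (-(w * t))) := by
      filter_upwards [self_mem_nhdsWithin] with t ht
      have ht : 0 < t := ht
      rw [genBernoulliFun_of_pos ht, Real.rpow_neg (div_pos ht (hexp ht)).le,
        Real.div_rpow ht.le (hexp ht).le, hF]
      have := Real.rpow_pos_of_pos ht s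
      simp only [neg_mul]
      field_simp
    have h2 : F =O[𝓝[>] 0] fun t => t ^ (s + 1) := by
      refine ((isBigO_refl (fun t : ℝ => t ^ s) _).mul (hO.mono nhdsWithin_le_nhds)).congr' h1.symm ?_
      filter_upwards [self_mem_nhdsWithin] with t ht
      rw [Real.rpow_add_one (ne_of_gt ht)]
    refine h2.trans_tendsto ?_
    have := (Real.continuousAt_rpow_const 0 (s + 1) (Or.inr (by linarith))).tendsto
    rw [Real.zero_rpow (by linarith)] at this
    exact this.mono_left nhdsWithin_le_nhds
  have htop : Tendsto F atTop (𝓝 0) := by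
    have h1 := tendsto_rpow_mul_exp_neg_mul_atTop_nhds_zero s w hw
    have h2 : Tendsto (fun t : ℝ => Real.exp (-(u * t)) * (1 - Real.exp (-t)) ^ s) atTop (𝓝 0) := by
      have h3 : Tendsto (fun t : ℝ => Real.exp (-(u * t))) atTop (𝓝 0) :=
        Real.tendsto_exp_neg_atTop_nhds_zero.comp (tendsto_id.const_mul_atTop hws)
      have h4 : Tendsto (fun t : ℝ => (1 - Real.exp (-t)) ^ s) atTop (𝓝 ((1 - 0) ^ s)) :=
        (tendsto_const_nhds.sub Real.tendsto_exp_neg_atTop_nhds_zero).rpow_const (Or.inl (by norm_num))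
      simpa using h3.mul h4
    have h5 := h2.sub h1
    rw [sub_zero] at h5
    refine h5.congr' ?_
    filter_upwards [eventually_gt_atTop 0] with t ht
    have := hAeq ht
    simp only at this
    rw [this, hF, neg_mul]
  have hderiv : ∀ t ∈ Set.Ioi (0 : ℝ), HasDerivAt F
      (-l * (Real.exp (-(l * t)) * (Real.exp t - 1) ^ s) + w * (t ^ s * Real.exp (-(w * t)))
        + s * (t ^ (s - 1) * Real.exp (-(w * t)) * evenTaylorRemainder (1 - s) 1 t)) t := by
    intro t ht
    have ht : 0 < t := ht
    have e1 (c : ℝ) : HasDerivAt (fun t => Real.exp (-(c * t))) (Real.exp (-(c * t)) * -c) t := by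
      simpa using ((hasDerivAt_id t).const_mul c).neg.exp
    have e2 : HasDerivAt (fun t => (Real.exp t - 1) ^ s)
        (Real.exp t * s * (Real.exp t - 1) ^ (s - 1)) t :=
      ((Real.hasDerivAt_exp t).sub_const 1).rpow_const (Or.inl (hexp ht).ne')
    have e3 : HasDerivAt (fun t : ℝ => t ^ s) (s * t ^ (s - 1)) t :=
      Real.hasDerivAt_rpow_const (Or.inl ht.ne')
    refine (((e1 l).mul e2).sub (e3.mul (e1 w))).congr_deriv ?_
    have e4 : t ^ (s - 1) * Real.exp (-(w * t)) * evenTaylorRemainder (1 - s) 1 t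
        = Real.exp (-(l * t)) * Real.exp t * (Real.exp t - 1) ^ (s - 1)
          - t ^ (s - 1) * Real.exp (-(w * t)) := by
      have : (t / (Real.exp t - 1)) ^ (1 - s) = (Real.exp t - 1) ^ (s - 1) / t ^ (s - 1) := by
        rw [← neg_sub s 1, Real.rpow_neg (div_pos ht (hexp ht)).le,
          Real.div_rpow ht.le (hexp ht).le, inv_div]
      have h6 : Real.exp (-(l * t)) * Real.exp t
          = Real.exp (-(w * t)) * Real.exp ((1 - s) / 2 * t) := by
        rw [← Real.exp_add, ← Real.exp_add]; congr 1; rw [hl]; ring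
      have h7 := Real.rpow_pos_of_pos ht (s - 1)
      rw [evenTaylorRemainder, genBernoulliFun_of_pos ht, this, h6]
      simp only [Finset.range_one, Finset.sum_singleton, mul_zero, genBernoulli_zero,
        Nat.factorial_zero, Nat.cast_one, div_one, pow_zero, mul_one]
      field_simp
    rw [e4]
    ring
  have hAB : MeasureTheory.IntegrableOn (fun t : ℝ => -l * (Real.exp (-(l * t)) * (Real.exp t - 1) ^ s)
      + w * (t ^ s * Real.exp (-(w * t)))) (Set.Ioi 0) := (hA.const_mul (-l)).add (hB.const_mul w)
  have key := MeasureTheory.integral_Ioi_of_hasDerivAt_of_tendsto hcont hderiv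
    (hAB.add (hint.const_mul s)) htop
  rw [MeasureTheory.integral_add hAB (hint.const_mul s),
    MeasureTheory.integral_add (hA.const_mul (-l)) (hB.const_mul w),
    MeasureTheory.integral_const_mul, MeasureTheory.integral_const_mul,
    MeasureTheory.integral_const_mul, hA', hB', hF0,
    show u + (s + 1) = l + 1 by rw [hu, hl]; ring, Real.Gamma_add_one hl0.ne',
    Real.Gamma_add_one hs0] at key
  have hw1 : w * ((1 / w) ^ (s + 1)) = w ^ (-s) := by
    rw [one_div, Real.inv_rpow hw.le, Real.rpow_add_one hw.ne', Real.rpow_neg hw.le]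
    field_simp
  have hGl := (Real.Gamma_pos_of_pos hl0).ne'
  have h8 : -l * (Real.Gamma u * (s * Real.Gamma s) / (l * Real.Gamma l))
      = -s * (Real.Gamma s * (Real.Gamma u / Real.Gamma l)) := by
    field_simp
  rw [h8, ← mul_assoc w, hw1] at key
  refine mul_left_cancel₀ hs0 ?_
  linarith

theorem Gamma_add_natCast_eq {s : ℝ} (hs : -1 < s) (hs0 : s ≠ 0) (n : ℕ) :
    Real.Gamma (s + n) = (ascPochhammer ℝ n).eval s * Real.Gamma s := by
  induction n with
  | zero => simp
  | succ n ih =>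
    have : s + n ≠ 0 := by
      rcases n with - | n
      · simpa using hs0
      · push_cast
        have : (0 : ℝ) ≤ n := n.cast_nonneg
        linarith
    rw [Nat.cast_succ, ← add_assoc, Real.Gamma_add_one this, ih, ascPochhammer_succ_eval]
    ring

/-! ### Watson's lemma for the ratio of Gamma values -/

theorem laplace_evenTaylorRemainder_isBigO {s : ℝ} (α : ℝ) (m : ℕ) (hs : 0 < s + 2 * m) :
    (∀ᶠ w : ℝ in atTop, MeasureTheory.IntegrableOn (fun t : ℝ => t ^ (s - 1) * Real.exp (-(w * t))
        * evenTaylorRemainder α m t) (Set.Ioi 0)) ∧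
      (fun w : ℝ => ∫ t in Set.Ioi (0 : ℝ), t ^ (s - 1) * Real.exp (-(w * t))
        * evenTaylorRemainder α m t) =O[atTop] fun w => w ^ (-(s + 2 * m)) := by
  obtain ⟨C, c, hC⟩ := exists_abs_evenTaylorRemainder_le α m
  have hle (w : ℝ) {t : ℝ} (ht : 0 < t) :
      ‖t ^ (s - 1) * Real.exp (-(w * t)) * evenTaylorRemainder α m t‖
        ≤ C * (t ^ ((s + 2 * m) - 1) * Real.exp (-((w - c) * t))) := by
    have h1 : t ^ ((s + 2 * m) - 1) = t ^ (s - 1) * t ^ (2 * m) := by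
      rw [← Real.rpow_natCast, ← Real.rpow_add ht]; congr 1; push_cast; ring
    have h2 : Real.exp (-((w - c) * t)) = Real.exp (-(w * t)) * Real.exp (c * t) := by
      rw [← Real.exp_add]; congr 1; ring
    rw [norm_mul, Real.norm_of_nonneg (by positivity), Real.norm_eq_abs, h1, h2]
    calc _ ≤ t ^ (s - 1) * Real.exp (-(w * t)) * (C * t ^ (2 * m) * Real.exp (c * t)) := by
          gcongr; exact hC t ht
      _ = _ := by ring
  have hbound {w : ℝ} (hw : c < w) : MeasureTheory.IntegrableOn
      (fun t : ℝ => C * (t ^ ((s + 2 * m) - 1) * Real.exp (-((w - c) * t)))) (Set.Ioi 0) :=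
    (integrableOn_rpow_mul_exp_neg_mul hs (sub_pos.2 hw)).const_mul C
  have hae (w : ℝ) : ∀ᵐ t ∂(MeasureTheory.volume.restrict (Set.Ioi (0 : ℝ))),
      ‖t ^ (s - 1) * Real.exp (-(w * t)) * evenTaylorRemainder α m t‖
        ≤ C * (t ^ ((s + 2 * m) - 1) * Real.exp (-((w - c) * t))) :=
    (MeasureTheory.ae_restrict_iff' measurableSet_Ioi).2 (Eventually.of_forall fun t ht => hle w ht)
  constructor
  · filter_upwards [eventually_gt_atTop c] with w hw
    refine (hbound hw).mono' ?_ (hae w)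
    have := measurable_evenTaylorRemainder α m
    exact Measurable.aestronglyMeasurable (by fun_prop)
  · refine IsBigO.of_bound (|C| * ((2 : ℝ) ^ (s + 2 * m) * Real.Gamma (s + 2 * m))) ?_
    filter_upwards [eventually_gt_atTop c, eventually_gt_atTop 0, eventually_ge_atTop (2 * c)]
      with w hwc hw0 hw2
    have hG := (Real.Gamma_pos_of_pos hs).le
    have h1 : (1 / (w - c)) ^ (s + 2 * m) ≤ 2 ^ (s + 2 * m) * w ^ (-(s + 2 * m)) := by
      rw [Real.rpow_neg hw0.le, ← Real.inv_rpow hw0.le, ← Real.mul_rpow (by norm_num) (by positivity)]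
      refine Real.rpow_le_rpow (one_div_nonneg.2 (by linarith)) ?_ hs.le
      rw [← div_eq_mul_inv, div_le_div_iff₀ (by linarith) hw0]
      linarith
    have h2 := MeasureTheory.norm_integral_le_of_norm_le (hbound hwc) (hae w)
    rw [MeasureTheory.integral_const_mul,
      Real.integral_rpow_mul_exp_neg_mul_Ioi hs (sub_pos.2 hwc)] at h2
    rw [Real.norm_of_nonneg (show 0 ≤ w ^ (-(s + 2 * m)) by positivity)]
    have h3 : 0 ≤ (1 / (w - c)) ^ (s + 2 * m) :=
      Real.rpow_nonneg (one_div_nonneg.2 (by linarith)) _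
    calc _ ≤ C * ((1 / (w - c)) ^ (s + 2 * m) * Real.Gamma (s + 2 * m)) := h2
      _ ≤ |C| * ((2 ^ (s + 2 * m) * w ^ (-(s + 2 * m))) * Real.Gamma (s + 2 * m)) := by
        gcongr
        exact le_abs_self C
      _ = _ := by ring

/-- The remainder of the expansion of a ratio of Gamma values in the powers `w ^ (-s - 2 * j)`.  With
the mean of the two arguments at `w + 1 / 2`, no other powers occur. -/
noncomputable def gammaRatioRemainder (s : ℝ) (m : ℕ) (w : ℝ) : ℝ :=
  Real.Gamma (w + (1 - s) / 2) / Real.Gamma (w + (1 + s) / 2)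
    - ∑ j ∈ Finset.range m, genBernoulli (2 * j) (1 - s) ((1 - s) / 2)
      * (ascPochhammer ℝ (2 * j)).eval s / ((2 * j).factorial : ℝ) * w ^ (-(s + 2 * j))

theorem gammaRatioRemainder_isBigO {s : ℝ} (hs : -1 < s) (hs0 : s ≠ 0) {m : ℕ} (hm : 1 ≤ m) :
    gammaRatioRemainder s m =O[atTop] fun w => w ^ (-(s + 2 * m)) := by
  obtain ⟨n, rfl⟩ := Nat.exists_eq_add_of_le' hm
  have hn : (0 : ℝ) ≤ n := n.cast_nonneg
  obtain ⟨hi, hO⟩ := laplace_evenTaylorRemainder_isBigO (s := s) (1 - s) (n + 1)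
    (by push_cast; linarith)
  have hi1 := (laplace_evenTaylorRemainder_isBigO (s := s) (1 - s) 1 (by push_cast; linarith)).1
  have hG : Real.Gamma s ≠ 0 := by
    have h := Real.Gamma_add_one hs0
    have h1 := Real.Gamma_pos_of_pos (show 0 < s + 1 by linarith)
    rw [h] at h1
    exact right_ne_zero_of_mul h1.ne'
  refine (hO.const_mul_left (Real.Gamma s)⁻¹).congr' ?_ EventuallyEq.rfl
  filter_upwards [hi, hi1, eventually_gt_atTop 0, eventually_gt_atTop (-((1 - s) / 2))]
    with w hi hi1 hw hws
  have key := Gamma_mul_Gamma_div_Gamma_eq hs hs0 hw (by linarith) hi1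
  have hsplit : ∀ t ∈ Set.Ioi (0 : ℝ),
      t ^ (s - 1) * Real.exp (-(w * t)) * evenTaylorRemainder (1 - s) 1 t
        = t ^ (s - 1) * Real.exp (-(w * t)) * evenTaylorRemainder (1 - s) (n + 1) t
          + ∑ j ∈ Finset.range n, genBernoulli (2 * (j + 1)) (1 - s) ((1 - s) / 2)
            / ((2 * (j + 1)).factorial : ℝ)
            * (t ^ (s + (2 * (j + 1) : ℕ) - 1) * Real.exp (-(w * t))) := fun t ht => by
    have h1 (j : ℕ) : t ^ (s + (2 * (j + 1) : ℕ) - 1) = t ^ (s - 1) * t ^ (2 * (j + 1)) := by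
      rw [← Real.rpow_natCast, ← Real.rpow_add ht]; congr 1; ring
    have h2 : evenTaylorRemainder (1 - s) 1 t = evenTaylorRemainder (1 - s) (n + 1) t
        + ∑ j ∈ Finset.range n, genBernoulli (2 * (j + 1)) (1 - s) ((1 - s) / 2)
          / ((2 * (j + 1)).factorial : ℝ) * t ^ (2 * (j + 1)) := by
      rw [evenTaylorRemainder, evenTaylorRemainder, Finset.sum_range_succ' _ n]
      simp only [Finset.range_one, Finset.sum_singleton]
      ring
    rw [h2, mul_add, Finset.mul_sum]
    congr 1
    refine Finset.sum_congr rfl fun j _ => ?_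
    rw [h1]; ring
  have hpos (j : ℕ) : 0 < s + (2 * (j + 1) : ℕ) := by
    push_cast
    have : (0 : ℝ) ≤ j := j.cast_nonneg
    linarith
  have hterm (j : ℕ) := (integrableOn_rpow_mul_exp_neg_mul (hpos j) hw).const_mul
    (genBernoulli (2 * (j + 1)) (1 - s) ((1 - s) / 2) / ((2 * (j + 1)).factorial : ℝ))
  rw [MeasureTheory.setIntegral_congr_fun measurableSet_Ioi hsplit,
    MeasureTheory.integral_add hi (MeasureTheory.integrable_finsetSum _ fun j _ => hterm j),
    MeasureTheory.integral_finsetSum _ fun j _ => hterm j] at key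
  have hval (j : ℕ) : ∫ t in Set.Ioi (0 : ℝ), genBernoulli (2 * (j + 1)) (1 - s) ((1 - s) / 2)
        / ((2 * (j + 1)).factorial : ℝ) * (t ^ (s + (2 * (j + 1) : ℕ) - 1) * Real.exp (-(w * t)))
      = Real.Gamma s * (genBernoulli (2 * (j + 1)) (1 - s) ((1 - s) / 2)
        * (ascPochhammer ℝ (2 * (j + 1))).eval s / ((2 * (j + 1)).factorial : ℝ)
        * w ^ (-(s + 2 * (j + 1 : ℕ)))) := by
    rw [MeasureTheory.integral_const_mul, Real.integral_rpow_mul_exp_neg_mul_Ioi (hpos j) hw,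
      Gamma_add_natCast_eq hs hs0, one_div, Real.inv_rpow hw.le, ← Real.rpow_neg hw.le]
    push_cast
    ring
  rw [Finset.sum_congr rfl fun j _ => hval j, ← Finset.mul_sum] at key
  rw [gammaRatioRemainder, Finset.sum_range_succ']
  simp only [mul_zero, genBernoulli_zero, ascPochhammer_zero, Polynomial.eval_one,
    Nat.factorial_zero, Nat.cast_one, div_one, mul_one, one_mul, Nat.cast_zero, add_zero]
  rw [inv_mul_eq_iff_eq_mul₀ hG]
  linarith

/-! ### Shifted powers -/

theorem tendsto_add_rpow_sub_rpow {p : ℝ} (hp : p < 1) (h : ℝ) :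
    Tendsto (fun M : ℕ => ((M : ℝ) + h) ^ p - (M : ℝ) ^ p) atTop (𝓝 0) := by
  have hd : HasDerivAt (fun u : ℝ => (1 + u) ^ p) (p * (1 + 0) ^ (p - 1)) 0 := by
    simpa using ((hasDerivAt_id (0 : ℝ)).const_add 1).rpow_const (p := p) (Or.inl (by norm_num))
  have hO := hd.differentiableAt.isBigO_sub
  simp only [add_zero, Real.one_rpow, sub_zero] at hO
  have hO2 := (isBigO_refl (fun M : ℕ => (M : ℝ) ^ p) atTop).mul
    (hO.comp_tendsto (tendsto_const_div_atTop_nhds_zero_nat h))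
  have h0 : Tendsto (fun M : ℕ => h * (M : ℝ) ^ (p - 1)) atTop (𝓝 0) := by
    simpa using ((tendsto_rpow_neg_atTop (y := 1 - p) (by linarith)).comp
      tendsto_natCast_atTop_atTop).const_mul h
  refine (hO2.congr' ?_ ?_).trans_tendsto h0
  · filter_upwards [eventually_gt_atTop 0,
      (tendsto_const_div_atTop_nhds_zero_nat h).eventually (lt_mem_nhds (show (-1 : ℝ) < 0 by norm_num))]
      with M hM hM1
    have hM' : (0 : ℝ) < M := by exact_mod_cast hM
    simp only [Function.comp_apply]
    rw [mul_sub, ← Real.mul_rpow hM'.le (by linarith), mul_one]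
    congr 2
    field_simp
  · filter_upwards [eventually_gt_atTop 0] with M hM
    have hM' : (0 : ℝ) < M := by exact_mod_cast hM
    simp only [Function.comp_apply]
    rw [Real.rpow_sub_one hM'.ne']
    ring

theorem tendsto_add_rpow_sub_rpow_sub_deriv {p : ℝ} (hp : p < 2) (h : ℝ) :
    Tendsto (fun M : ℕ => ((M : ℝ) + h) ^ p - (M : ℝ) ^ p - p * h * (M : ℝ) ^ (p - 1))
      atTop (𝓝 0) := by
  have hd : HasDerivAt (fun u : ℝ => (1 + u) ^ p) p 0 := by
    simpa using ((hasDerivAt_id (0 : ℝ)).const_add 1).rpow_const (p := p) (Or.inl (by norm_num))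
  have ha : AnalyticAt ℝ (fun u : ℝ => (1 + u) ^ p) 0 :=
    Real.one_add_rpow_hasFPowerSeriesAt_zero.analyticAt
  have hO := ha.hasFPowerSeriesAt.isBigO_sub_partialSum_pow 2
  have hO1 : (fun u : ℝ => (1 + u) ^ p - (1 + p * u)) =O[𝓝 0] fun u : ℝ => u ^ 2 := by
    refine hO.congr (fun u => ?_) fun u => by simp
    simp [FormalMultilinearSeries.partialSum, Finset.sum_range_succ, hd.deriv,
      mul_comm]
  have hO2 := (isBigO_refl (fun M : ℕ => (M : ℝ) ^ p) atTop).mul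
    (hO1.comp_tendsto (tendsto_const_div_atTop_nhds_zero_nat h))
  have h0 : Tendsto (fun M : ℕ => h ^ 2 * (M : ℝ) ^ (p - 2)) atTop (𝓝 0) := by
    simpa using ((tendsto_rpow_neg_atTop (y := 2 - p) (by linarith)).comp
      tendsto_natCast_atTop_atTop).const_mul (h ^ 2)
  refine (hO2.congr' ?_ ?_).trans_tendsto h0
  · filter_upwards [eventually_gt_atTop 0,
      (tendsto_const_div_atTop_nhds_zero_nat h).eventually (lt_mem_nhds (show (-1 : ℝ) < 0 by norm_num))]
      with M hM hM1
    have hM' : (0 : ℝ) < M := by exact_mod_cast hM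
    simp only [Function.comp_apply]
    have e : (M : ℝ) * (1 + h / M) = M + h := by field_simp
    rw [mul_sub, ← Real.mul_rpow hM'.le (by linarith), Real.rpow_sub_one hM'.ne', e]
    field_simp
    ring
  · filter_upwards [eventually_gt_atTop 0] with M hM
    have hM' : (0 : ℝ) < M := by exact_mod_cast hM
    simp only [Function.comp_apply]
    rw [Real.rpow_sub hM', Real.rpow_two]
    field_simp

/-! ### Summation over an arithmetic progression -/

/-- Along the points `N k + d` the remainders of the Gamma ratio are summable, and their sum has the
order of a single one. -/
theorem gammaRatioRemainder_sum {s d : ℝ} (hs : -1 < s) (hs0 : s ≠ 0) (hd : -1 / 2 ≤ d) {m : ℕ}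
    (hm : 1 ≤ m) :
    (∀ N : ℕ, 1 ≤ N → Summable fun i : ℕ => gammaRatioRemainder s m (N * (i + 1) + d)) ∧
      (fun N : ℕ => ∑' i : ℕ, gammaRatioRemainder s m (N * (i + 1) + d))
        =O[atTop] fun N : ℕ => (N : ℝ) ^ (-(s + 2 * m)) := by
  have hO := gammaRatioRemainder_isBigO hs hs0 hm
  have hm' : (1 : ℝ) ≤ m := by exact_mod_cast hm
  set p := s + 2 * (m : ℝ) with hp
  have hp1 : 1 < p := by linarith
  have hsum : Summable fun i : ℕ => ((i : ℝ) + 1) ^ (-p) := by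
    simpa using (summable_nat_add_iff 1).2 (Real.summable_nat_rpow.2 (by linarith : -p < -1))
  -- As `d ≥ -1 / 2`, the points stay above half of `N k`, uniformly in `N` and `k`.
  have hw (N i : ℕ) (hN : 1 ≤ N) : (N : ℝ) / 2 * (i + 1) ≤ N * (i + 1) + d := by
    have h1 : (1 : ℝ) ≤ N := by exact_mod_cast hN
    have h2 : (0 : ℝ) ≤ i := i.cast_nonneg
    nlinarith
  have hpow (N i : ℕ) (hN : 1 ≤ N) :
      ‖((N : ℝ) * (i + 1) + d) ^ (-p)‖ ≤ ((N : ℝ) / 2) ^ (-p) * ((i : ℝ) + 1) ^ (-p) := by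
    have h1 : (1 : ℝ) ≤ N := by exact_mod_cast hN
    have h3 : 0 < (N : ℝ) / 2 * (i + 1) := by positivity
    rw [Real.norm_of_nonneg (Real.rpow_nonneg (h3.le.trans (hw N i hN)) _),
      ← Real.mul_rpow (by positivity) (by positivity)]
    exact Real.rpow_le_rpow_of_nonpos h3 (hw N i hN) (by linarith)
  constructor
  · intro N hN
    have hN' : (0 : ℝ) < N := by exact_mod_cast hN
    have ht : Tendsto (fun i : ℕ => (N : ℝ) * (i + 1) + d) atTop atTop :=
      tendsto_atTop_add_const_right _ _
        ((tendsto_atTop_add_const_right _ _ tendsto_natCast_atTop_atTop).const_mul_atTop hN')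
    exact summable_of_isBigO_nat
      (Summable.of_norm_bounded (hsum.mul_left _) fun i => hpow N i hN) (hO.comp_tendsto ht)
  · obtain ⟨C, hC0, hC⟩ := hO.exists_pos
    obtain ⟨w₀, hw₀⟩ := eventually_atTop.1 hC.bound
    refine IsBigO.of_bound (C * ((2 : ℝ) ^ p * ∑' i : ℕ, ((i : ℝ) + 1) ^ (-p))) ?_
    filter_upwards [eventually_ge_atTop 1, eventually_ge_atTop ⌈2 * w₀⌉₊] with N hN hN2
    have hN' : (1 : ℝ) ≤ N := by exact_mod_cast hN
    have hN2' : 2 * w₀ ≤ N := (Nat.le_ceil _).trans (by exact_mod_cast hN2)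
    have hb (i : ℕ) : ‖gammaRatioRemainder s m (N * (i + 1) + d)‖
        ≤ C * (((N : ℝ) / 2) ^ (-p) * ((i : ℝ) + 1) ^ (-p)) := by
      refine (hw₀ _ ?_).trans (mul_le_mul_of_nonneg_left (hpow N i hN) hC0.le)
      have h2 : (0 : ℝ) ≤ i := i.cast_nonneg
      nlinarith [hw N i hN]
    have h4 := tsum_of_norm_bounded ((hsum.mul_left (((N : ℝ) / 2) ^ (-p))).mul_left C).hasSum hb
    rw [tsum_mul_left, tsum_mul_left] at h4
    refine h4.trans (le_of_eq ?_)
    rw [Real.norm_of_nonneg (by positivity), Real.div_rpow (by positivity) (by norm_num),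
      Real.rpow_neg (by norm_num : (0 : ℝ) ≤ 2)]
    field_simp

/-- Summing the expansion of the Gamma ratio over `N k + d`, `k ≥ 1`: each power of the expansion
contributes a Hurwitz zeta value.  Only the leading power needs to be corrected by the integral of
`x ^ (-s)`. -/
theorem exists_tendsto_sum_gammaRatio {s d : ℝ} (hs : -1 < s) (hs0 : s ≠ 0) (hs1 : s ≠ 1)
    (hd : -1 / 2 ≤ d) {m : ℕ} (hm : 1 ≤ m) :
    ∃ E X : ℕ → ℝ, (E =O[atTop] fun N : ℕ => (N : ℝ) ^ (-(s + 2 * m))) ∧ ∀ N : ℕ, 1 ≤ N →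
      (X N : ℂ) = ∑ j ∈ Finset.range m, ((genBernoulli (2 * j) (1 - s) ((1 - s) / 2)
          * (ascPochhammer ℝ (2 * j)).eval s / ((2 * j).factorial : ℝ)
          * (N : ℝ) ^ (-(s + 2 * j)) : ℝ) : ℂ)
          * hurwitzZetaPos ((s + 2 * j : ℝ) : ℂ) (1 + d / N) ∧
      Tendsto (fun M : ℕ => ∑ k ∈ Finset.Icc 1 M, Real.Gamma (N * k + d + (1 - s) / 2)
          / Real.Gamma (N * k + d + (1 + s) / 2)
          - (N : ℝ) ^ (-s) * ((M : ℝ) + (1 / 2 + d / N)) ^ (1 - s) / (1 - s)) atTop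
        (𝓝 (X N + E N)) := by
  obtain ⟨hsum, hO⟩ := gammaRatioRemainder_sum hs hs0 hd hm
  set c : ℕ → ℝ := fun j => genBernoulli (2 * j) (1 - s) ((1 - s) / 2)
          * (ascPochhammer ℝ (2 * j)).eval s / ((2 * j).factorial : ℝ) with hc
  have hex (N : ℕ) (hN : 1 ≤ N) (j : ℕ) : ∃ z : ℝ,
      hurwitzZetaPos ((s + 2 * j : ℝ) : ℂ) (1 + d / N) = z ∧
      Tendsto (fun M : ℕ => ∑ k ∈ Finset.range M, ((k : ℝ) + (1 + d / N)) ^ (-(s + 2 * j))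
        - ((M : ℝ) + (1 + d / N) - 1 / 2) ^ (1 - (s + 2 * j)) / (1 - (s + 2 * j))) atTop (𝓝 z) := by
    have hN' : (1 : ℝ) ≤ N := by exact_mod_cast hN
    have hj : (0 : ℝ) ≤ j := j.cast_nonneg
    refine exists_tendsto_hurwitzZetaPos ?_ (by linarith) ?_
    · have : -(1 / 2) ≤ d / N := by
        rw [le_div_iff₀ (by linarith)]; linarith
      linarith
    · rcases j with - | j
      · simpa using hs1
      · push_cast at hj ⊢
        have : (0 : ℝ) ≤ j := j.cast_nonneg
        intro h
        linarith
  choose! z hz hzt using hex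
  refine ⟨_, fun N => ∑ j ∈ Finset.range m, c j * (N : ℝ) ^ (-(s + 2 * j)) * z N j, hO,
    fun N hN => ⟨?_, ?_⟩⟩
  · rw [Complex.ofReal_sum]
    refine Finset.sum_congr rfl fun j _ => ?_
    rw [hz N hN j, Complex.ofReal_mul]
  have hN' : (1 : ℝ) ≤ N := by exact_mod_cast hN
  have hdN : -(1 / 2) ≤ d / N := by
    rw [le_div_iff₀ (by linarith)]; linarith
  -- The integral corrections of the powers other than the leading one tend to `0`.
  have hcorr (j : ℕ) : Tendsto (fun M : ℕ => ((M : ℝ) + (1 + d / N) - 1 / 2) ^ (1 - (s + 2 * (j + 1 : ℕ)))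
      / (1 - (s + 2 * (j + 1 : ℕ)))) atTop (𝓝 0) := by
    have hj : (0 : ℝ) ≤ j := j.cast_nonneg
    have h3 : Tendsto (fun M : ℕ => (M : ℝ) + (1 + d / N) - 1 / 2) atTop atTop := by
      simp_rw [add_sub_assoc]
      exact tendsto_atTop_add_const_right _ _ tendsto_natCast_atTop_atTop
    have h4 := (tendsto_rpow_neg_atTop (y := s + 2 * (j + 1 : ℕ) - 1) (by push_cast; linarith)).comp h3
    simpa using h4.div_const (1 - (s + 2 * (j + 1 : ℕ)))
  have hmain : Tendsto (fun M : ℕ => ∑ j ∈ Finset.range m, c j * (N : ℝ) ^ (-(s + 2 * j))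
      * ∑ k ∈ Finset.range M, ((k : ℝ) + (1 + d / N)) ^ (-(s + 2 * j))
      - (N : ℝ) ^ (-s) * ((M : ℝ) + (1 / 2 + d / N)) ^ (1 - s) / (1 - s)) atTop
      (𝓝 (∑ j ∈ Finset.range m, c j * (N : ℝ) ^ (-(s + 2 * j)) * z N j)) := by
    obtain ⟨n, rfl⟩ := Nat.exists_eq_add_of_le' hm
    have h0 := (hzt N hN 0).const_mul (c 0 * (N : ℝ) ^ (-(s + 2 * (0 : ℕ))))
    have h1 := tendsto_finsetSum (Finset.range n) fun j _ =>
      ((hzt N hN (j + 1)).add (hcorr j)).const_mul (c (j + 1) * (N : ℝ) ^ (-(s + 2 * (j + 1 : ℕ))))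
    simp only [sub_add_cancel, add_zero] at h1
    have h2 := h1.add h0
    simp only [Finset.sum_range_succ' _ n]
    refine h2.congr fun M => ?_
    have hc0 : c 0 = 1 := by simp [hc, genBernoulli_zero]
    have he : (M : ℝ) + (1 + d / N) - 1 / 2 = M + (1 / 2 + d / N) := by ring
    simp only [Nat.cast_zero, mul_zero, add_zero, he, hc0, one_mul]
    ring
  refine (hmain.add (hsum N hN).hasSum.tendsto_sum_nat).congr fun M => ?_
  have hterm (k : ℕ) : Real.Gamma ((N : ℝ) * (k + 1 : ℕ) + d + (1 - s) / 2)
      / Real.Gamma ((N : ℝ) * (k + 1 : ℕ) + d + (1 + s) / 2)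
      = ∑ j ∈ Finset.range m, c j * (N : ℝ) ^ (-(s + 2 * j))
        * ((k : ℝ) + (1 + d / N)) ^ (-(s + 2 * j)) + gammaRatioRemainder s m (N * (k + 1) + d) := by
    have hw : (N : ℝ) * (k + 1) + d = N * (k + (1 + d / N)) := by field_simp; ring
    have hk : (0 : ℝ) ≤ k + (1 + d / N) := by
      have : (0 : ℝ) ≤ k := k.cast_nonneg
      linarith
    rw [gammaRatioRemainder, Nat.cast_succ, hw]
    simp only [Real.mul_rpow (show (0 : ℝ) ≤ N by linarith) hk, ← mul_assoc, hc]
    ring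
  have hicc : ∑ k ∈ Finset.Icc 1 M, Real.Gamma (N * k + d + (1 - s) / 2)
        / Real.Gamma (N * k + d + (1 + s) / 2)
      = ∑ k ∈ Finset.range M, Real.Gamma ((N : ℝ) * (k + 1 : ℕ) + d + (1 - s) / 2)
        / Real.Gamma ((N : ℝ) * (k + 1 : ℕ) + d + (1 + s) / 2) := by
    rw [Finset.range_eq_Ico, Finset.sum_Ico_add' (fun k : ℕ => Real.Gamma ((N : ℝ) * k + d + (1 - s) / 2)
      / Real.Gamma ((N : ℝ) * k + d + (1 + s) / 2)) 0 M 1]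
    rfl
  rw [hicc, Finset.sum_congr rfl fun k _ => hterm k, Finset.sum_add_distrib, Finset.sum_comm]
  simp only [Finset.mul_sum]
  ring

/-! ### The expansion of the renormalized sum -/

theorem mainTheorem4 (r : ℝ) (hr : r < 2) (hr0 : r ≠ 0) (hr1 : r ≠ 1) (m : ℕ) (hm : 1 ≤ m) :
    ∃ L : ℕ → ℝ,
      (∀ N : ℕ, 1 ≤ N → Tendsto (fun M : ℕ => renormalizedSum r N M) atTop (𝓝 (L N))) ∧
      (fun N : ℕ => (L N : ℂ) - zetaExpansion r m N)
        =O[atTop] (fun N : ℕ => (N : ℝ) ^ (r - 1 - 2 * (m : ℝ))) := by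
  obtain ⟨E₁, X₁, hE₁, h₁⟩ := exists_tendsto_sum_gammaRatio (s := 1 - r) (d := (2 - r) / 2)
    (by linarith) (sub_ne_zero.2 hr1.symm) (by simpa using hr0) (by linarith) hm
  obtain ⟨E₂, X₂, hE₂, h₂⟩ := exists_tendsto_sum_gammaRatio (s := 2 - r) (d := (1 - r) / 2)
    (by linarith) (by linarith) (fun h => hr1 (by linarith)) (by linarith) hm
  refine ⟨fun N => 2 * r * (1 + r) * (X₁ N + E₁ N) + 2 * r * (1 - r) * (X₂ N + E₂ N), ?_, ?_⟩
  · intro N hN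
    have hN' : (0 : ℝ) < N := by exact_mod_cast hN
    have hr1' : r - 1 ≠ 0 := sub_ne_zero.2 hr1
    -- The last two summands replace the integral corrections, powers of `M + 1 / 2 + d / N`, by
    -- their expansions in powers of `M`; as `r < 2`, those need two terms and one term.
    have t := (((h₁ N hN).2.const_mul (2 * r * (1 + r))).add
      ((h₂ N hN).2.const_mul (2 * r * (1 - r)))).add
      (((tendsto_add_rpow_sub_rpow_sub_deriv hr (1 / 2 + (2 - r) / 2 / N)).const_mul
        (2 * (1 + r) * (N : ℝ) ^ (r - 1))).add
      ((tendsto_add_rpow_sub_rpow (p := r - 1) (by linarith) (1 / 2 + (1 - r) / 2 / N)).const_mul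
        (-2 * r * (N : ℝ) ^ (r - 2))))
    simp only [mul_zero, add_zero] at t
    refine t.congr fun M => ?_
    have hp : (N : ℝ) ^ (r - 1) = N ^ (r - 2) * N := by
      rw [← Real.rpow_add_one hN'.ne']; congr 1; ring
    have e₁ : ∀ k : ℕ, (N : ℝ) * k + (2 - r) / 2 + r / 2 = N * k + 1 := fun k => by ring
    have e₂ : ∀ k : ℕ, (N : ℝ) * k + (2 - r) / 2 + (1 + (1 - r)) / 2 = N * k + 2 - r :=
      fun k => by ring
    have e₃ : ∀ k : ℕ, (N : ℝ) * k + (1 - r) / 2 + (r - 1) / 2 = N * k := fun k => by ring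
    have e₄ : ∀ k : ℕ, (N : ℝ) * k + (1 - r) / 2 + (1 + (2 - r)) / 2 = N * k + 2 - r :=
      fun k => by ring
    have e₅ : 1 - (2 - r) = r - 1 := by ring
    simp only [e₁, e₂, e₃, e₄, e₅, sub_sub_cancel, neg_sub, hp, renormalizedSum]
    field_simp
    ring
  · have hF : (fun N : ℕ => 2 * r * (1 + r) * E₁ N + 2 * r * (1 - r) * E₂ N)
        =O[atTop] fun N : ℕ => (N : ℝ) ^ (r - 1 - 2 * (m : ℝ)) := by
      have e : -(1 - r + 2 * (m : ℝ)) = r - 1 - 2 * m := by ring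
      rw [e] at hE₁
      refine (hE₁.const_mul_left _).add ((hE₂.trans (IsBigO.of_bound 1 ?_)).const_mul_left _)
      filter_upwards [eventually_ge_atTop 1] with N hN
      rw [one_mul, Real.norm_of_nonneg (by positivity), Real.norm_of_nonneg (by positivity)]
      exact Real.rpow_le_rpow_of_exponent_le (by exact_mod_cast hN) (by linarith)
    refine IsBigO.congr' (Complex.isBigO_ofReal_left.2 hF) ?_ EventuallyEq.rfl
    filter_upwards [eventually_ge_atTop 1] with N hN
    have e₁ (j : ℕ) : -(1 - r + 2 * (j : ℝ)) = r - 1 - 2 * j := by ring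
    have e₂ (j : ℕ) : -(2 - r + 2 * (j : ℝ)) = r - 2 - 2 * j := by ring
    have e₃ : 1 - (2 - r) = r - 1 := by ring
    have hX₁ := (h₁ N hN).1
    have hX₂ := (h₂ N hN).1
    simp only [e₁, e₂, e₃, sub_sub_cancel, div_div] at hX₁ hX₂
    rw [zetaExpansion, ← hX₁, ← hX₂]
    push_cast
    ring
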